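/- Let $N\ge 1$ be an odd integer. For $P=(\bar x,\bar y)\in(\mathbf Z/N\mathbf Z)^2$ choose representatives $x,y\in\mathbf Z$ of $\bar x,\bar y$ with $x-y$ odd, and put $$F(P)=-\frac14\cdot\frac{\cos(\pi x/N)+\cos(\pi y/N)}{\cos(\pi x/N)-\cos(\pi y/N)}\in\mathbf R ,$$ which does not depend on the choice of the representatives. For a positive integer $m$ let $U_m$ (respectively $V_m$) be the finite set of the matrices $\begin{pmatrix}x&-y\\y'&x'\end{pmatrix}\in M_2(\mathbf Z)$ with $xx'+yy'=m$, $x,x'$ odd, $y,y'$ even, and $x>|y|$, $x'>|y'|$ (respectively $y>|x|$, $y'>|x'|$). Let $$\theta_m=\sum_{M\in U_m}[M]-\sum_{M\in V_m}[M]=\sum_{L}u_L^{\theta}\,[L]\in\mathbf Z[M_2(\mathbf Z)] .$$ Let $l$ be an odd prime number and let $P\in(\mathbf Z/N\mathbf Z)^2$. Then, with $u_L^\theta$ the coefficients of $\theta_l$ and $M_2(\mathbf Z)$ acting on column vectors in $(\mathbf Z/N\mathbf Z)^2$ through reduction modulo $N$, $$\sum_L u_L^{\theta}\,F(LP)=F(P)+l\,F(lP).$$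 -/

import Mathlib

open Matrix

noncomputable section

namespace EisensteinCycles

/-- The set of matrices `(x, -y; y', x')` of determinant `x x' + y y' = m` with
`x, x'` odd, `y, y'` even, `x > |y|` and `x' > |y'|`. -/
def U (m : ℕ) : Set (Matrix (Fin 2) (Fin 2) ℤ) :=
  {M | ∃ x y y' x' : ℤ, M = !![x, -y; y', x'] ∧ x * x' + y * y' = (m : ℤ) ∧
    Odd x ∧ Odd x' ∧ Even y ∧ Even y' ∧ |y| < x ∧ |y'| < x'}

/-- The set of matrices `(x, -y; y', x')` of determinant `x x' + y y' = m` with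
`x, x'` odd, `y, y'` even, `y > |x|` and `y' > |x'|`. -/
def V (m : ℕ) : Set (Matrix (Fin 2) (Fin 2) ℤ) :=
  {M | ∃ x y y' x' : ℤ, M = !![x, -y; y', x'] ∧ x * x' + y * y' = (m : ℤ) ∧
    Odd x ∧ Odd x' ∧ Even y ∧ Even y' ∧ |x| < y ∧ |x'| < y'}

theorem entry_bound {a b b' a' m : ℤ} (h : a * a' + b * b' = m) (hb : |b| < a) (hb' : |b'| < a') :
    a ≤ m ∧ a' ≤ m := by
  have h0 := abs_nonneg b
  have h0' := abs_nonneg b'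
  have h1 : |b| * |b'| ≤ (a - 1) * (a' - 1) :=
    mul_le_mul (by omega) (by omega) h0' (by omega)
  have h2 : -(|b| * |b'|) ≤ b * b' := by
    rw [← abs_mul]; exact neg_abs_le _
  constructor <;> nlinarith

theorem finite_of_entries (m : ℕ) (S : Set (Matrix (Fin 2) (Fin 2) ℤ))
    (h : ∀ M ∈ S, ∀ i j, |M i j| ≤ (m : ℤ)) : S.Finite := by
  refine (Set.finite_Icc (α := Fin 2 → Fin 2 → ℤ)
    (fun _ _ => -(m : ℤ)) (fun _ _ => (m : ℤ))).subset ?_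
  intro M hM
  exact ⟨fun i j => (abs_le.mp (h M hM i j)).1, fun i j => (abs_le.mp (h M hM i j)).2⟩

theorem U_finite (m : ℕ) : (U m).Finite := by
  refine finite_of_entries m _ ?_
  rintro M ⟨x, y, y', x', rfl, h, -, -, -, -, h1, h2⟩ i j
  obtain ⟨h3, h4⟩ := entry_bound h h1 h2
  have h5 := abs_nonneg y
  have h6 := abs_nonneg y'
  have h7 : |x| = x := abs_of_nonneg (by omega)
  have h8 : |x'| = x' := abs_of_nonneg (by omega)
  fin_cases i <;> fin_cases j <;> simp <;> omega

theorem V_finite (m : ℕ) : (V m).Finite := by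
  refine finite_of_entries m _ ?_
  rintro M ⟨x, y, y', x', rfl, h, -, -, -, -, h1, h2⟩ i j
  obtain ⟨h3, h4⟩ := entry_bound (a := y) (a' := y') (b := x) (b' := x') (m := m)
    (by rw [← h]; ring) h1 h2
  have h5 := abs_nonneg x
  have h6 := abs_nonneg x'
  have h7 : |y| = y := abs_of_nonneg (by omega)
  have h8 : |y'| = y' := abs_of_nonneg (by omega)
  fin_cases i <;> fin_cases j <;> simp <;> omega

/-- The element `θ_m = ∑_{M ∈ U_m} [M] - ∑_{M ∈ V_m} [M]` of the free abelian group
`ℤ[M₂(ℤ)]`; the coefficient of `[L]` in it is `theta m L`. -/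
def theta (m : ℕ) : Matrix (Fin 2) (Fin 2) ℤ →₀ ℤ :=
  ∑ M ∈ (U_finite m).toFinset, Finsupp.single M 1 -
    ∑ M ∈ (V_finite m).toFinset, Finsupp.single M 1

/-- The value of the function `F` on a pair `(x, y)` of integers. -/
def cosQuot (N : ℕ) (x y : ℤ) : ℝ :=
  -(1 / 4) * ((Real.cos (Real.pi * x / N) + Real.cos (Real.pi * y / N)) /
    (Real.cos (Real.pi * x / N) - Real.cos (Real.pi * y / N)))

/-- For odd `N`, every `P` in `(ℤ/Nℤ)²` has a representative `(x, y)` with `x - y` odd. -/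
theorem exists_rep {N : ℕ} (hN : Odd N) (P : Fin 2 → ZMod N) :
    ∃ x y : ℤ, (x : ZMod N) = P 0 ∧ (y : ZMod N) = P 1 ∧ Odd (x - y) := by
  obtain ⟨x, hx⟩ := ZMod.intCast_surjective (P 0)
  obtain ⟨y, hy⟩ := ZMod.intCast_surjective (P 1)
  rcases Int.even_or_odd (x - y) with h | h
  · refine ⟨x + N, y, by simpa using hx, hy, ?_⟩
    have : x + N - y = (x - y) + (N : ℤ) := by ring
    rw [this]
    exact h.add_odd (by exact_mod_cast hN)
  · exact ⟨x, y, hx, hy, h⟩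

open Classical in
/-- The function `F` on `(ℤ/Nℤ)²`, for odd `N`: the value of `cosQuot` at any representative
`(x, y)` with `x - y` odd (and `0`, never used, if there is none). -/
def F (N : ℕ) (P : Fin 2 → ZMod N) : ℝ :=
  if h : ∃ q : ℤ × ℤ, (q.1 : ZMod N) = P 0 ∧ (q.2 : ZMod N) = P 1 ∧ Odd (q.1 - q.2) then
    cosQuot N h.choose.1 h.choose.2
  else 0

theorem cos_shift {N : ℕ} (hN : N ≠ 0) (x k : ℤ) :
    Real.cos (Real.pi * ((x + N * k : ℤ) : ℝ) / N) = (-1) ^ k * Real.cos (Real.pi * x / N) := by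
  have hN' : (N : ℝ) ≠ 0 := by exact_mod_cast hN
  rw [← Real.cos_add_int_mul_pi]
  congr 1
  push_cast
  field_simp

/-- `cosQuot` does not depend on the representative with `x - y` odd. -/
theorem cosQuot_congr {N : ℕ} (hN : Odd N) {x y x' y' : ℤ}
    (hx : (x : ZMod N) = (x' : ZMod N)) (hy : (y : ZMod N) = (y' : ZMod N))
    (h : Odd (x - y)) (h' : Odd (x' - y')) : cosQuot N x y = cosQuot N x' y' := by
  obtain ⟨a, ha⟩ := (ZMod.intCast_eq_intCast_iff_dvd_sub x x' N).mp hx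
  obtain ⟨b, hb⟩ := (ZMod.intCast_eq_intCast_iff_dvd_sub y y' N).mp hy
  obtain rfl : x' = x + N * a := by omega
  obtain rfl : y' = y + N * b := by omega
  have hab : Even ((N : ℤ) * (a - b)) := by
    have : (N : ℤ) * (a - b) = (x + N * a - (y + N * b)) - (x - y) := by ring
    rw [this]
    exact h'.sub_odd h
  have hNz : Odd (N : ℤ) := by exact_mod_cast hN
  have hab' : Even (a - b) := by
    rcases Int.even_mul.mp hab with h1 | h1
    · exact absurd hNz (Int.not_odd_iff_even.mpr h1)
    · exact h1
  have hs : ((-1 : ℝ)) ^ a = (-1) ^ b := by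
    obtain ⟨c, hc⟩ := hab'
    obtain rfl : a = b + (c + c) := by omega
    rw [zpow_add₀ (by norm_num), Even.neg_one_zpow ⟨c, rfl⟩, mul_one]
  have hb0 : ((-1 : ℝ)) ^ b ≠ 0 := zpow_ne_zero _ (by norm_num)
  unfold cosQuot
  rw [cos_shift hN.pos.ne', cos_shift hN.pos.ne', hs, ← mul_add, ← mul_sub,
    mul_div_mul_left _ _ hb0]

/-- For odd `N`, `F` is given by its formula on every representative with `x - y` odd. -/
theorem F_eq {N : ℕ} (hN : Odd N) (P : Fin 2 → ZMod N) (x y : ℤ)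
    (hx : (x : ZMod N) = P 0) (hy : (y : ZMod N) = P 1) (h : Odd (x - y)) :
    F N P = cosQuot N x y := by
  have hex : ∃ q : ℤ × ℤ, (q.1 : ZMod N) = P 0 ∧ (q.2 : ZMod N) = P 1 ∧ Odd (q.1 - q.2) :=
    ⟨(x, y), hx, hy, h⟩
  rw [F, dif_pos hex]
  obtain ⟨h1, h2, h3⟩ := hex.choose_spec
  exact cosQuot_congr hN (h1.trans hx.symm) (h2.trans hy.symm) h3 h

/-- For odd `N` the denominator in the formula for `F` does not vanish. -/
theorem cos_sub_cos_ne_zero {N : ℕ} (hN : Odd N) {x y : ℤ} (h : Odd (x - y)) :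
    Real.cos (Real.pi * x / N) - Real.cos (Real.pi * y / N) ≠ 0 := by
  have hN' : (N : ℝ) ≠ 0 := by exact_mod_cast hN.pos.ne'
  have hpi := Real.pi_ne_zero
  intro h0
  obtain ⟨k, hk | hk⟩ := Real.cos_eq_cos_iff.mp (sub_eq_zero.mp h0)
  · field_simp at hk
    have : y = 2 * k * N + x := by exact_mod_cast (by linarith : (y : ℝ) = 2 * k * N + x)
    rw [this] at h
    revert h
    rw [imp_false, Int.not_odd_iff_even]
    exact ⟨-(k * N), by ring⟩
  · field_simp at hk
    have : y = 2 * k * N - x := by exact_mod_cast (by linarith : (y : ℝ) = 2 * k * N - x)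
    rw [this] at h
    revert h
    rw [imp_false, Int.not_odd_iff_even]
    exact ⟨x - k * N, by ring⟩

end EisensteinCycles

end

/-!
In the coordinates `u = π (x + y) / (2 N)` and `v = π (x - y) / (2 N)` the function `F` is
`cot u * cot v / 4`, and its denominator does not vanish because `x + y` and `x - y` are odd.
The matrices of `U l` act on `(u, v)` as those matrices `(p, q; r, s)` of determinant `l` with
`|r| < p`, `|q| < s` and rows and columns of odd sum for which `p + q - r - s` is divisible by `4`.
For a matrix of `V l` with rows `a`, `b` in these coordinates, `(-b, a)` is such a matrix for which
`p + q - r - s` is not divisible by `4`, and the passage from `(a, b)` to `(-b, a)` changes the sign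
of the product of cotangents. So `theta l` becomes a sum, without signs, over the set `heilbronn l`
of all such matrices, and the claim is (`sum_heilbronn_cot_mul_cot`)
`∑ cot (p u + q v) cot (r u + s v) = cot u cot v + l cot (l u) cot (l v)`.

For fixed `v`, both sides are rational functions of `exp (2 i u)` with simple poles, and it is the
poles that are compared. Each summand is expanded into partial fractions in `u`
(`cot_mul_cot_eq_polarPart`): a constant `-sign r`, the poles of the first factor, and those of the
second. The constants cancel under `(p, q; r, s) ↦ (p, -q; -r, s)` (`sum_sign_heilbronn`).
At the poles `p u + q v ∈ π ℤ` attached to a first row `a = (p, q)` with `q ≠ 0`, the residue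
depends only on the class modulo `a` of the second row `b`, and it is odd in `b`. With `ε` the sign
of `q`, the row `ε a` is the second row of exactly one matrix of the set whose first row is
congruent to `-ε b` modulo `2 a`, and its residue is the opposite one
(`polarPart_add_polarPart_eq_zero`, `sum_polarPart_cancel`). What survives are the first rows with
`q = 0`, that is the matrices `(1, 0; 0, l)` and `(l, 0; r, 1)` with `r` even and `|r| < l`. They are
summed by the multiplication formula for the cotangent (`sum_polarPart_upper`).
-/

namespace EisensteinCycles

/-! ### The multiplication formula for the cotangent -/

theorem sum_inv_one_sub_mul_pow {K : Type*} [Field K] {n : ℕ} {ζ A : K}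
    (hζ : IsPrimitiveRoot ζ n) (hA : A ^ n ≠ 1) :
    ∑ t ∈ Finset.range n, (1 - A * ζ ^ t)⁻¹ = n * (1 - A ^ n)⁻¹ := by
  have hn : n ≠ 0 := by rintro rfl; simp at hA
  have hpow (t : ℕ) : (A * ζ ^ t) ^ n = A ^ n := by
    rw [mul_pow, ← pow_mul, mul_comm t n, pow_mul, hζ.pow_eq_one, one_pow, mul_one]
  have hne (t : ℕ) : 1 - A * ζ ^ t ≠ 0 := by
    intro h
    apply hA
    rw [← hpow t, ← sub_eq_zero.mp h, one_pow]
  have hA' : 1 - A ^ n ≠ 0 := sub_ne_zero.mpr hA.symm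
  have hgeom (t : ℕ) :
      (1 - A * ζ ^ t)⁻¹ = (∑ j ∈ Finset.range n, (A * ζ ^ t) ^ j) * (1 - A ^ n)⁻¹ := by
    rw [inv_eq_iff_eq_inv, eq_comm, mul_inv, inv_inv, ← hpow t]
    have h := mul_neg_geom_sum (A * ζ ^ t) n
    have h0 : (∑ j ∈ Finset.range n, (A * ζ ^ t) ^ j) ≠ 0 := by
      intro h0
      rw [h0, mul_zero, hpow] at h
      exact hA' h.symm
    rw [← h]
    field_simp
  have hsum (j : ℕ) (hj : j ∈ Finset.range n) (hj0 : j ≠ 0) :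
      ∑ t ∈ Finset.range n, (A * ζ ^ t) ^ j = 0 := by
    have h1 : ζ ^ j ≠ 1 := hζ.pow_ne_one_of_pos_of_lt hj0 (Finset.mem_range.mp hj)
    have h2 : ∑ t ∈ Finset.range n, (ζ ^ j) ^ t = 0 := by
      have h := mul_neg_geom_sum (ζ ^ j) n
      rw [← pow_mul, mul_comm j n, pow_mul, hζ.pow_eq_one, one_pow, sub_self] at h
      exact (mul_eq_zero.mp h).resolve_left (sub_ne_zero.mpr h1.symm)
    calc ∑ t ∈ Finset.range n, (A * ζ ^ t) ^ j
        = A ^ j * ∑ t ∈ Finset.range n, (ζ ^ j) ^ t := by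
          rw [Finset.mul_sum]
          refine Finset.sum_congr rfl fun t _ => ?_
          rw [mul_pow, ← pow_mul, ← pow_mul, mul_comm t j]
      _ = 0 := by rw [h2, mul_zero]
  rw [Finset.sum_congr rfl fun t _ => hgeom t, ← Finset.sum_mul, Finset.sum_comm,
    Finset.sum_eq_single_of_mem 0 (Finset.mem_range.mpr (Nat.pos_of_ne_zero hn)) hsum]
  simp

/-- The step `m` may be any integer prime to `n`, since it only permutes the points
`x + t π / n` modulo `π`. -/
theorem sum_cot_add_mul_pi_div {n m : ℕ} (hmn : m.Coprime n) (x : ℝ)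
    (hx : Real.sin (n * x) ≠ 0) :
    ∑ t ∈ Finset.range n, Real.cot (x + m * t * Real.pi / n) = n * Real.cot (n * x) := by
  have hn : n ≠ 0 := by rintro rfl; simp at hx
  have hn' : (n : ℂ) ≠ 0 := by exact_mod_cast hn
  have hζ := Complex.isPrimitiveRoot_exp_of_coprime m n hn hmn
  set ζ := Complex.exp (2 * Real.pi * Complex.I * (m / n)) with hζdef
  set A := Complex.exp (2 * Complex.I * x) with hAdef
  have hAn : A ^ n = Complex.exp (2 * Complex.I * (n * x : ℂ)) := by
    rw [hAdef, ← Complex.exp_nat_mul]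
    congr 1
    ring
  have hA : A ^ n ≠ 1 := by
    intro h
    rw [hAn, Complex.exp_eq_one_iff] at h
    obtain ⟨k, hk⟩ := h
    apply hx
    rw [Real.sin_eq_zero_iff]
    refine ⟨k, ?_⟩
    have h2 : (2 * Complex.I : ℂ) ≠ 0 := by simp
    have h3 : (n * x : ℂ) = k * Real.pi := mul_left_cancel₀ h2 (by rw [hk]; ring)
    exact_mod_cast h3.symm
  have hcot (w : ℂ) (hw : Complex.exp (2 * Complex.I * w) ≠ 1) :
      Complex.cot w = Complex.I - 2 * Complex.I * (1 - Complex.exp (2 * Complex.I * w))⁻¹ := by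
    rw [Complex.cot_eq_exp_ratio]
    have h : 1 - Complex.exp (2 * Complex.I * w) ≠ 0 := sub_ne_zero.mpr hw.symm
    field_simp
    linear_combination (1 + Complex.exp (2 * Complex.I * w)) * Complex.I_sq
  have hterm (t : ℕ) : Complex.exp (2 * Complex.I * (x + m * t * Real.pi / n : ℂ)) = A * ζ ^ t := by
    rw [hAdef, hζdef, ← Complex.exp_nat_mul, ← Complex.exp_add]
    congr 1
    field_simp
  have hne (t : ℕ) : A * ζ ^ t ≠ 1 := by
    intro h
    apply hA
    have h1 : (A * ζ ^ t) ^ n = A ^ n := by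
      rw [mul_pow, ← pow_mul, mul_comm t n, pow_mul, hζ.pow_eq_one, one_pow, mul_one]
    rw [← h1, h, one_pow]
  apply Complex.ofReal_injective
  push_cast
  rw [hcot _ (by rw [← hAn]; exact hA), ← hAn]
  rw [Finset.sum_congr rfl fun t _ => by rw [hcot _ (by rw [hterm]; exact hne t), hterm]]
  rw [Finset.sum_sub_distrib, ← Finset.mul_sum, sum_inv_one_sub_mul_pow hζ hA]
  simp
  ring

theorem cot_add_int_mul_pi (x : ℝ) (k : ℤ) : Real.cot (x + k * Real.pi) = Real.cot x := by
  rw [Real.cot_eq_cos_div_sin, Real.cot_eq_cos_div_sin, Real.cos_add_int_mul_pi,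
    Real.sin_add_int_mul_pi, mul_div_mul_left _ _ (zpow_ne_zero _ (by norm_num))]

theorem cot_neg (x : ℝ) : Real.cot (-x) = -Real.cot x := by
  rw [Real.cot_eq_cos_div_sin, Real.cot_eq_cos_div_sin, Real.cos_neg, Real.sin_neg, div_neg]

theorem cot_mul_cot {x y : ℝ} (hx : Real.sin x ≠ 0) (hy : Real.sin y ≠ 0)
    (hxy : Real.sin (y - x) ≠ 0) :
    Real.cot x * Real.cot y = -1 + Real.cot (y - x) * (Real.cot x - Real.cot y) := by
  have h : Real.cot x - Real.cot y = Real.sin (y - x) / (Real.sin x * Real.sin y) := by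
    rw [Real.sin_sub, Real.cot_eq_cos_div_sin, Real.cot_eq_cos_div_sin]
    field_simp
  rw [h, Real.cot_eq_cos_div_sin (y - x), div_mul_div_cancel₀ hxy, Real.cos_sub,
    Real.cot_eq_cos_div_sin, Real.cot_eq_cos_div_sin]
  field_simp
  ring

/-! ### Partial fractions of a product of two cotangents -/

/-- The poles in `u` of `cot (p * u + q * v)`, one for each class modulo `π`,
indexed by `k < |p|`. Dividing `k * π` by `|p|` rather than by `p` makes `pole` invariant under
`(p, q) ↦ (-p, -q)`. -/
noncomputable def pole (p q : ℤ) (v : ℝ) (k : ℕ) : ℝ :=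
  k * Real.pi / p.natAbs - q * v / p

theorem mul_pole_add {p : ℤ} (hp : p ≠ 0) (q : ℤ) (v : ℝ) (k : ℕ) :
    p * pole p q v k + q * v = ((p.sign * k : ℤ) : ℝ) * Real.pi := by
  have hp' : (p : ℝ) ≠ 0 := by exact_mod_cast hp
  have hs : (p : ℝ) = p.sign * p.natAbs := by
    rw [← Int.cast_natCast p.natAbs, ← Int.cast_mul, Int.sign_mul_natAbs]
  have hn : (p.natAbs : ℝ) ≠ 0 := by simpa using hp
  unfold pole
  push_cast
  have h1 : (p : ℝ) * (k * Real.pi / p.natAbs) = p.sign * k * Real.pi := by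
    calc (p : ℝ) * (k * Real.pi / p.natAbs)
        = p.sign * p.natAbs * (k * Real.pi / p.natAbs) := by rw [← hs]
      _ = _ := by field_simp
  have h2 : (p : ℝ) * (q * v / p) = q * v := by field_simp
  rw [mul_sub, h1, h2]; ring

theorem sum_cot_sub_pole {p q : ℤ} (hp : p ≠ 0) {u v : ℝ} (h : Real.sin (p * u + q * v) ≠ 0) :
    ∑ k ∈ Finset.range p.natAbs, Real.cot (u - pole p q v k) = p * Real.cot (p * u + q * v) := by
  have hp' : (p : ℝ) ≠ 0 := by exact_mod_cast hp
  have hn : (p.natAbs : ℝ) ≠ 0 := by simpa using hp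
  have habs : (p.natAbs : ℝ) = p ∨ (p.natAbs : ℝ) = -p := by
    rw [Nat.cast_natAbs, Int.cast_abs]
    exact abs_choice _
  have hmul : (p.natAbs : ℝ) * -(u + q * v / p) = -(p * u + q * v) ∨
      (p.natAbs : ℝ) * -(u + q * v / p) = p * u + q * v := by
    rcases habs with h | h
    · left; rw [h]; field_simp
    · right; rw [h]; field_simp
  have hsin : Real.sin (p.natAbs * -(u + q * v / p)) ≠ 0 := by
    rcases hmul with h' | h' <;> rw [h']
    · rw [Real.sin_neg]; exact neg_ne_zero.mpr h
    · exact h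
  have key := sum_cot_add_mul_pi_div (Nat.coprime_one_left p.natAbs) _ hsin
  have hterm (k : ℕ) : Real.cot (u - pole p q v k) =
      -Real.cot (-(u + q * v / p) + (1 : ℕ) * k * Real.pi / p.natAbs) := by
    rw [← cot_neg]
    congr 1
    unfold pole
    push_cast
    ring
  rw [Finset.sum_congr rfl fun k _ => hterm k, Finset.sum_neg_distrib, key]
  rcases habs with h1 | h1 <;> rcases hmul with h2 | h2 <;> rw [h2, h1]
  · rw [cot_neg]; ring
  · have : p * u + q * v = 0 := by
      rw [h1] at h2; field_simp at h2; linarith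
    rw [this]; simp [Real.cot_eq_cos_div_sin]
  · have : p * u + q * v = 0 := by
      rw [h1] at h2; field_simp at h2; linarith
    rw [this]; simp [Real.cot_eq_cos_div_sin]
  · ring

/-- The part of the partial fraction expansion in `u` of
`cot (p * u + q * v) * cot (r * u + s * v)` supported on the poles of the first factor.
It is `0` for `p = 0`, when the first factor is constant in `u`. -/
noncomputable def polarPart (u v : ℝ) (p q r s : ℤ) : ℝ :=
  (p : ℝ)⁻¹ * ∑ k ∈ Finset.range p.natAbs,
    Real.cot (r * pole p q v k + s * v) * Real.cot (u - pole p q v k)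

theorem sin_sub_pole_ne_zero {p q : ℤ} (hp : p ≠ 0) {u v : ℝ}
    (h : Real.sin (p * u + q * v) ≠ 0) (k : ℕ) : Real.sin (u - pole p q v k) ≠ 0 := by
  intro h0
  obtain ⟨n, hn⟩ := Real.sin_eq_zero_iff.mp h0
  apply h
  rw [Real.sin_eq_zero_iff]
  refine ⟨p * n + p.sign * k, ?_⟩
  have := mul_pole_add hp q v k
  push_cast at this ⊢
  linear_combination (p : ℝ) * hn - this

/-- The partial fraction expansion in `u` of the product of two cotangents. The constant is the
mean of the limits of the product at `u = ± i ∞`, where `cot` tends to `∓ i`. The hypothesis on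
the determinant ensures that the two factors have no pole in common. -/
theorem cot_mul_cot_eq_polarPart {p q r s : ℤ} (hp : 0 < p) {u v : ℝ}
    (ha : Real.sin (p * u + q * v) ≠ 0) (hb : Real.sin (r * u + s * v) ≠ 0)
    (hdet : Real.sin (((p * s - q * r : ℤ) : ℝ) * v) ≠ 0) :
    Real.cot (p * u + q * v) * Real.cot (r * u + s * v) =
      -(r.sign : ℝ) + polarPart u v p q r s + polarPart u v r s p q := by
  have hp' : (p : ℝ) ≠ 0 := by exact_mod_cast hp.ne'
  have hsa := sum_cot_sub_pole hp.ne' ha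
  rcases eq_or_ne r 0 with rfl | hr
  · simp only [polarPart, Int.cast_zero, zero_mul, zero_add, Int.natAbs_zero,
      Finset.range_zero, Finset.sum_empty, Int.sign_zero, neg_zero, mul_zero, add_zero]
    rw [← Finset.mul_sum, hsa]
    field_simp
  have hr' : (r : ℝ) ≠ 0 := by exact_mod_cast hr
  have hsb := sum_cot_sub_pole hr hb
  have hpoles (k m : ℕ) : Real.sin (pole p q v k - pole r s v m) ≠ 0 := by
    intro h0
    obtain ⟨n, hn⟩ := Real.sin_eq_zero_iff.mp h0
    apply hdet
    rw [Real.sin_eq_zero_iff]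
    refine ⟨p * r * n - r * (p.sign * k) + p * (r.sign * m), ?_⟩
    have h1 := mul_pole_add hp.ne' q v k
    have h2 := mul_pole_add hr s v m
    push_cast at h1 h2 ⊢
    linear_combination (p * r : ℝ) * hn + (r : ℝ) * h1 - (p : ℝ) * h2
  have hA (k : ℕ) : Real.sin (r * pole p q v k + s * v) ≠ 0 := by
    intro h0
    obtain ⟨n, hn⟩ := Real.sin_eq_zero_iff.mp h0
    apply hdet
    rw [Real.sin_eq_zero_iff]
    refine ⟨p * n - r * (p.sign * k), ?_⟩
    have h1 := mul_pole_add hp.ne' q v k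
    push_cast at h1 ⊢
    linear_combination (p : ℝ) * hn + (r : ℝ) * h1
  have hB (m : ℕ) : Real.sin (p * pole r s v m + q * v) ≠ 0 := by
    intro h0
    obtain ⟨n, hn⟩ := Real.sin_eq_zero_iff.mp h0
    apply hdet
    rw [Real.sin_eq_zero_iff]
    refine ⟨p * (r.sign * m) - r * n, ?_⟩
    have h1 := mul_pole_add hr s v m
    push_cast at h1 ⊢
    linear_combination - (r : ℝ) * hn - (p : ℝ) * h1
  have e1 (k : ℕ) := sum_cot_sub_pole hr (hA k)
  have e2 (m : ℕ) := sum_cot_sub_pole hp.ne' (hB m)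
  have hprod (k m : ℕ) : Real.cot (u - pole p q v k) * Real.cot (u - pole r s v m) =
      -1 + Real.cot (u - pole p q v k) * Real.cot (pole p q v k - pole r s v m)
        + Real.cot (u - pole r s v m) * Real.cot (pole r s v m - pole p q v k) := by
    have h : u - pole r s v m - (u - pole p q v k) = pole p q v k - pole r s v m := by ring
    have h' : Real.cot (pole r s v m - pole p q v k) = -Real.cot (pole p q v k - pole r s v m) := by
      rw [← cot_neg, neg_sub]
    rw [cot_mul_cot (sin_sub_pole_ne_zero hp.ne' ha k) (sin_sub_pole_ne_zero hr hb m)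
      (by rw [h]; exact hpoles k m), h, h']
    ring
  have hnat : (p.natAbs : ℝ) = p := by
    rw [← Int.cast_natCast p.natAbs, Int.natAbs_of_nonneg hp.le]
  have hnat' : (r.natAbs : ℝ) = r * r.sign := by
    rw [← Int.cast_mul, Int.mul_sign_self, Int.cast_natCast]
  -- Expand both factors by the multiplication formula, split each term by `hprod`, and sum the
  -- coefficients back by `e1` and `e2`.
  have hdouble : (p * Real.cot (p * u + q * v)) * (r * Real.cot (r * u + s * v)) =
      -(p * (r * r.sign)) +
      ∑ k ∈ Finset.range p.natAbs,
        Real.cot (u - pole p q v k) * (r * Real.cot (r * pole p q v k + s * v)) +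
      ∑ m ∈ Finset.range r.natAbs,
        Real.cot (u - pole r s v m) * (p * Real.cot (p * pole r s v m + q * v)) := by
    rw [← hsa, ← hsb, Finset.sum_mul_sum]
    simp only [hprod, Finset.sum_add_distrib, ← Finset.mul_sum, e1]
    congr 1
    · congr 1
      simp only [Finset.sum_const, Finset.card_range, nsmul_eq_mul, hnat, hnat']
      ring
    · rw [Finset.sum_comm]
      simp only [← Finset.mul_sum, e2]
  have h1 : ∑ k ∈ Finset.range p.natAbs,
        Real.cot (u - pole p q v k) * (r * Real.cot (r * pole p q v k + s * v)) =
        r * (p * polarPart u v p q r s) := by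
    rw [polarPart, mul_inv_cancel_left₀ hp', Finset.mul_sum]
    exact Finset.sum_congr rfl fun _ _ => by ring
  have h2 : ∑ m ∈ Finset.range r.natAbs,
        Real.cot (u - pole r s v m) * (p * Real.cot (p * pole r s v m + q * v)) =
        p * (r * polarPart u v r s p q) := by
    rw [polarPart, mul_inv_cancel_left₀ hr', Finset.mul_sum]
    exact Finset.sum_congr rfl fun _ _ => by ring
  rw [h1, h2] at hdouble
  refine mul_left_cancel₀ (mul_ne_zero hp' hr') ?_
  linear_combination hdouble

/-- Both polar parts have the same poles. There the argument of the other factor changes by the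
sign `-ε` and a multiple of `π`. -/
theorem polarPart_add_polarPart_eq_zero {p : ℤ} (hp : p ≠ 0) (q r s j ε : ℤ) (hε : ε = 1 ∨ ε = -1)
    (u v : ℝ) :
    polarPart u v p q r s + polarPart u v (ε * p) (ε * q) (j * p - ε * r) (j * q - ε * s) = 0 := by
  have hp' : (p : ℝ) ≠ 0 := by exact_mod_cast hp
  have hpole (k : ℕ) : pole (ε * p) (ε * q) v k = pole p q v k := by
    unfold pole
    rcases hε with rfl | rfl <;> simp
  have hn : (ε * p).natAbs = p.natAbs := by rcases hε with rfl | rfl <;> simp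
  have hc (k : ℕ) : Real.cot ((j * p - ε * r : ℤ) * pole p q v k + (j * q - ε * s : ℤ) * v) =
      -ε * Real.cot (r * pole p q v k + s * v) := by
    have h := mul_pole_add hp q v k
    have harg : ((j * p - ε * r : ℤ) : ℝ) * pole p q v k + (j * q - ε * s : ℤ) * v =
        -ε * (r * pole p q v k + s * v) + ((j * (p.sign * k) : ℤ) : ℝ) * Real.pi := by
      push_cast at h ⊢
      linear_combination (j : ℝ) * h
    rw [harg, cot_add_int_mul_pi]
    rcases hε with rfl | rfl
    · rw [Int.cast_one, neg_one_mul, neg_one_mul, cot_neg]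
    · simp
  have hεε : (ε : ℝ)⁻¹ * ε = 1 := by rcases hε with rfl | rfl <;> simp
  unfold polarPart
  simp only [hpole, hn, hc, mul_assoc]
  rw [← Finset.mul_sum]
  push_cast
  rw [mul_inv]
  linear_combination -((p : ℝ)⁻¹ * ∑ k ∈ Finset.range p.natAbs,
    Real.cot (r * pole p q v k + s * v) * Real.cot (u - pole p q v k)) * hεε

/-! ### The set of matrices in the new coordinates -/

/-- The quadruples `(p, q, r, s)`, read as the matrices `(p, q; r, s)`, of determinant `l` with
`|r| < p` and `|q| < s` whose rows and columns have odd sums. The box `[-l, l]⁴` only serves to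
make the set visibly finite: see `mem_heilbronn`. -/
noncomputable def heilbronn (l : ℕ) : Finset (ℤ × ℤ × ℤ × ℤ) :=
  (Finset.Icc (-(l : ℤ)) l ×ˢ Finset.Icc (-(l : ℤ)) l ×ˢ
    Finset.Icc (-(l : ℤ)) l ×ˢ Finset.Icc (-(l : ℤ)) l).filter fun M =>
      M.1 * M.2.2.2 - M.2.1 * M.2.2.1 = l ∧ |M.2.2.1| < M.1 ∧ |M.2.1| < M.2.2.2 ∧
        Odd (M.1 + M.2.1) ∧ Odd (M.2.2.1 + M.2.2.2) ∧
        Odd (M.1 + M.2.2.1) ∧ Odd (M.2.1 + M.2.2.2)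

theorem mem_heilbronn {l : ℕ} {p q r s : ℤ} : (p, q, r, s) ∈ heilbronn l ↔
    p * s - q * r = l ∧ |r| < p ∧ |q| < s ∧
      Odd (p + q) ∧ Odd (r + s) ∧ Odd (p + r) ∧ Odd (q + s) := by
  simp only [heilbronn, Finset.mem_filter, Finset.mem_product, Finset.mem_Icc,
    and_iff_right_iff_imp]
  rintro ⟨h, h1, h2, -⟩
  obtain ⟨h3, h4⟩ := entry_bound (a := p) (a' := s) (b := r) (b' := -q) (m := l)
    (by linarith) h1 (by rwa [abs_neg])
  rw [abs_lt] at h1 h2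
  omega

/-- The constant terms of the partial fraction expansions add up to `0`. -/
theorem sum_sign_heilbronn (l : ℕ) : ∑ M ∈ heilbronn l, (M.2.2.1.sign : ℝ) = 0 := by
  refine Finset.sum_involution (fun M _ => (M.1, -M.2.1, -M.2.2.1, M.2.2.2)) ?_ ?_ ?_ ?_
  · rintro ⟨p, q, r, s⟩ -
    simp
  · rintro ⟨p, q, r, s⟩ - h h'
    apply h
    have : r = 0 := by
      simp only [Prod.mk.injEq] at h'
      omega
    simp [this]
  · rintro ⟨p, q, r, s⟩ h
    rw [mem_heilbronn] at h ⊢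
    simp only [abs_neg]
    obtain ⟨h1, h2, h3, h4, h5, h6, h7⟩ := h
    refine ⟨by linarith, h2, h3, ?_⟩
    simp only [Int.odd_iff] at *
    omega
  · rintro ⟨p, q, r, s⟩ -
    simp

/-! ### Cancellation of the poles -/

/-- The integer `t` for which `2 * t * |c|` is the even multiple of `c` nearest to `x`. It is unique
when `x + c` is odd, as then `x` is not an odd multiple of `c`. -/
def halfMultiple (x c : ℤ) : ℤ := (x + |c|) / (2 * |c|)

theorem halfMultiple_eq {x c t : ℤ} (h : |2 * t * |c| - x| < |c|) : halfMultiple x c = t := by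
  rw [abs_lt] at h
  unfold halfMultiple
  exact (Int.ediv_eq_iff_of_pos (by linarith)).mpr ⟨by nlinarith, by nlinarith⟩

theorem abs_halfMultiple_sub_lt {x c : ℤ} (hc : c ≠ 0) (h : Odd (x + c)) :
    |2 * halfMultiple x c * |c| - x| < |c| := by
  have hc' : 0 < |c| := abs_pos.mpr hc
  have h1 := Int.mul_ediv_add_emod (x + |c|) (2 * |c|)
  have h2 := Int.emod_nonneg (x + |c|) (by linarith : 2 * |c| ≠ 0)
  have h3 := Int.emod_lt_of_pos (x + |c|) (by linarith : 0 < 2 * |c|)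
  have h4 : (x + |c|) % (2 * |c|) ≠ 0 := by
    intro h0
    have h5 : Even (x + |c|) :=
      even_iff_two_dvd.mpr ((Dvd.intro _ rfl).trans (Int.dvd_of_emod_eq_zero h0))
    rw [Int.even_add, even_abs, ← Int.even_add] at h5
    exact Int.not_odd_iff_even.mpr h5 h
  have h5 : 2 * halfMultiple x c * |c| = 2 * |c| * ((x + |c|) / (2 * |c|)) := by
    unfold halfMultiple
    ring
  rw [h5, abs_lt]
  omega

/-- From a matrix of the set with rows `a`, `b` to the one with rows `2 * t * a - ε * b`, `ε * a`. -/
theorem mem_heilbronn_forward {l : ℕ} {p q r s ε t : ℤ} (hε : ε = 1 ∨ ε = -1) (hq : 0 < ε * q)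
    (ht : |2 * t * (ε * q) - s| < ε * q) (h : (p, q, r, s) ∈ heilbronn l) :
    (2 * t * p - ε * r, 2 * t * q - ε * s, ε * p, ε * q) ∈ heilbronn l := by
  rw [mem_heilbronn] at h ⊢
  obtain ⟨h1, h2, h3, h4, h5, h6, h7⟩ := h
  simp only [abs_lt] at *
  -- The even multiple `2 * t * (ε * q)` is within `ε * q` of `s > ε * q`, so it is positive.
  have ht1 : 1 ≤ t := by
    by_contra h0
    rcases hε with rfl | rfl <;> nlinarith
  have htp : p ≤ t * p := by nlinarith
  have e1 : 2 * t * p = 2 * (t * p) := by ring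
  have e2 : 2 * t * q = 2 * (t * q) := by ring
  have e3 : 2 * t * (ε * q) = 2 * (ε * (t * q)) := by ring
  refine ⟨?_, ?_, ?_, ?_⟩
  · rcases hε with rfl | rfl <;> linear_combination h1
  · rcases hε with rfl | rfl <;> omega
  · rcases hε with rfl | rfl <;> omega
  · simp only [Int.odd_iff] at *
    rcases hε with rfl | rfl <;> omega

/-- From a matrix of the set with rows `a`, `b` to the one with rows `ε * b`, `2 * t * b - ε * a`;
this undoes the map of `mem_heilbronn_forward`. -/
theorem mem_heilbronn_backward {l : ℕ} {p q r s ε t : ℤ} (hε : ε = 1 ∨ ε = -1) (hr : 0 < ε * r)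
    (ht : |2 * t * (ε * r) - p| < ε * r) (h : (p, q, r, s) ∈ heilbronn l) :
    (ε * r, ε * s, 2 * t * r - ε * p, 2 * t * s - ε * q) ∈ heilbronn l := by
  rw [mem_heilbronn] at h ⊢
  obtain ⟨h1, h2, h3, h4, h5, h6, h7⟩ := h
  simp only [abs_lt] at *
  have ht1 : 1 ≤ t := by
    by_contra h0
    rcases hε with rfl | rfl <;> nlinarith
  have hts : s ≤ t * s := by nlinarith
  have e1 : 2 * t * s = 2 * (t * s) := by ring
  have e2 : 2 * t * r = 2 * (t * r) := by ring
  have e3 : 2 * t * (ε * r) = 2 * (ε * (t * r)) := by ring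
  refine ⟨?_, ?_, ?_, ?_⟩
  · rcases hε with rfl | rfl <;> linear_combination h1
  · rcases hε with rfl | rfl <;> omega
  · rcases hε with rfl | rfl <;> omega
  · simp only [Int.odd_iff] at *
    rcases hε with rfl | rfl <;> omega

theorem sign_eq_one_or_neg_one {q : ℤ} (hq : q ≠ 0) : q.sign = 1 ∨ q.sign = -1 := by
  rcases lt_or_gt_of_ne hq with h | h
  · exact Or.inr (Int.sign_eq_neg_one_of_neg h)
  · exact Or.inl (Int.sign_eq_one_of_pos h)

theorem sign_mul_of_pos {ε p : ℤ} (hε : ε = 1 ∨ ε = -1) (hp : 0 < p) : (ε * p).sign = ε := by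
  rcases hε with rfl | rfl <;> simp [Int.sign_eq_one_of_pos hp]

theorem abs_mul_of_pos {ε p : ℤ} (hε : ε = 1 ∨ ε = -1) (hp : 0 < p) : |ε * p| = p := by
  rcases hε with rfl | rfl <;> simp [abs_of_pos hp]

/-- The rows `a = (p, q)` with `q ≠ 0` contribute no pole: up to sign, each occurs as first and as
second row equally often, with opposite residues. -/
theorem sum_polarPart_cancel (l : ℕ) (u v : ℝ) :
    ∑ M ∈ heilbronn l with M.2.1 ≠ 0, polarPart u v M.1 M.2.1 M.2.2.1 M.2.2.2 +
      ∑ M ∈ heilbronn l with M.2.2.1 ≠ 0, polarPart u v M.2.2.1 M.2.2.2 M.1 M.2.1 = 0 := by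
  rw [← eq_neg_iff_add_eq_zero, ← Finset.sum_neg_distrib]
  refine Finset.sum_nbij'
    (fun M => (2 * halfMultiple M.2.2.2 M.2.1 * M.1 - M.2.1.sign * M.2.2.1,
      2 * halfMultiple M.2.2.2 M.2.1 * M.2.1 - M.2.1.sign * M.2.2.2,
      M.2.1.sign * M.1, M.2.1.sign * M.2.1))
    (fun M => (M.2.2.1.sign * M.2.2.1, M.2.2.1.sign * M.2.2.2,
      2 * halfMultiple M.1 M.2.2.1 * M.2.2.1 - M.2.2.1.sign * M.1,
      2 * halfMultiple M.1 M.2.2.1 * M.2.2.2 - M.2.2.1.sign * M.2.1)) ?_ ?_ ?_ ?_ ?_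
  · rintro ⟨p, q, r, s⟩ h
    simp only [Finset.mem_filter, ne_eq] at h ⊢
    obtain ⟨hM, hq⟩ := h
    have hM' := mem_heilbronn.mp hM
    have hp : 0 < p := (abs_nonneg r).trans_lt hM'.2.1
    have hε := sign_eq_one_or_neg_one hq
    refine ⟨mem_heilbronn_forward hε ?_ ?_ hM, ?_⟩
    · rw [Int.sign_mul_self_eq_abs]; exact abs_pos.mpr hq
    · rw [Int.sign_mul_self_eq_abs]
      exact abs_halfMultiple_sub_lt hq (by rw [add_comm]; exact hM'.2.2.2.2.2.2)
    · exact mul_ne_zero (by rcases hε with h | h <;> rw [h] <;> decide) hp.ne'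
  · rintro ⟨p, q, r, s⟩ h
    simp only [Finset.mem_filter, ne_eq] at h ⊢
    obtain ⟨hM, hr⟩ := h
    have hM' := mem_heilbronn.mp hM
    have hs : 0 < s := (abs_nonneg q).trans_lt hM'.2.2.1
    have hε := sign_eq_one_or_neg_one hr
    refine ⟨mem_heilbronn_backward hε ?_ ?_ hM, ?_⟩
    · rw [Int.sign_mul_self_eq_abs]; exact abs_pos.mpr hr
    · rw [Int.sign_mul_self_eq_abs]
      exact abs_halfMultiple_sub_lt hr hM'.2.2.2.2.2.1
    · exact mul_ne_zero (by rcases hε with h | h <;> rw [h] <;> decide) hs.ne'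
  · rintro ⟨p, q, r, s⟩ h
    simp only [Finset.mem_filter, ne_eq] at h ⊢
    obtain ⟨hM, hq⟩ := h
    have hM' := mem_heilbronn.mp hM
    have hp : 0 < p := (abs_nonneg r).trans_lt hM'.2.1
    have hε := sign_eq_one_or_neg_one hq
    generalize halfMultiple s q = t
    generalize q.sign = ε at *
    have ht : halfMultiple (2 * t * p - ε * r) (ε * p) = t := by
      apply halfMultiple_eq
      rw [abs_mul_of_pos hε hp, sub_sub_cancel]
      rcases hε with rfl | rfl <;> simpa using hM'.2.1
    rw [sign_mul_of_pos hε hp, ht]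
    simp only [Prod.mk.injEq]
    rcases hε with rfl | rfl <;> refine ⟨?_, ?_, ?_, ?_⟩ <;> ring
  · rintro ⟨p, q, r, s⟩ h
    simp only [Finset.mem_filter, ne_eq] at h ⊢
    obtain ⟨hM, hr⟩ := h
    have hM' := mem_heilbronn.mp hM
    have hs : 0 < s := (abs_nonneg q).trans_lt hM'.2.2.1
    have hε := sign_eq_one_or_neg_one hr
    generalize halfMultiple p r = t
    generalize r.sign = ε at *
    have ht : halfMultiple (2 * t * s - ε * q) (ε * s) = t := by
      apply halfMultiple_eq
      rw [abs_mul_of_pos hε hs, sub_sub_cancel]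
      rcases hε with rfl | rfl <;> simpa using hM'.2.2.1
    rw [sign_mul_of_pos hε hs, ht]
    simp only [Prod.mk.injEq]
    rcases hε with rfl | rfl <;> refine ⟨?_, ?_, ?_, ?_⟩ <;> ring
  · rintro ⟨p, q, r, s⟩ h
    simp only [Finset.mem_filter, ne_eq] at h ⊢
    obtain ⟨hM, hq⟩ := h
    have hp : 0 < p := (abs_nonneg r).trans_lt (mem_heilbronn.mp hM).2.1
    exact eq_neg_of_add_eq_zero_left
      (polarPart_add_polarPart_eq_zero hp.ne' q r s _ _ (sign_eq_one_or_neg_one hq) u v)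

/-! ### The surviving poles -/

theorem heilbronn_filter_eq_zero {l : ℕ} (hl : l.Prime) (hl2 : Odd l) :
    (heilbronn l).filter (fun M => M.2.1 = 0) = insert (1, 0, 0, (l : ℤ))
      ((Finset.range l).image fun t : ℕ => ((l : ℤ), 0, 2 * (t : ℤ) - (l - 1), 1)) := by
  ext ⟨p, q, r, s⟩
  have hl3 : (1 : ℤ) < l := by exact_mod_cast hl.one_lt
  have hl2' : Odd (l : ℤ) := by exact_mod_cast hl2
  simp only [Finset.mem_filter, mem_heilbronn, Finset.mem_insert, Finset.mem_image,
    Finset.mem_range, Prod.mk.injEq]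
  simp only [Int.odd_iff, abs_lt] at *
  constructor
  · rintro ⟨⟨h, h2, h3, h4, h5, h6, h7⟩, rfl⟩
    have hps : p * s = l := by linarith
    have hdvd : p.toNat ∣ l := by
      rw [← Int.natCast_dvd_natCast, Int.toNat_of_nonneg (by omega)]
      exact ⟨s, hps.symm⟩
    rcases (Nat.dvd_prime hl).mp hdvd with h0 | h0
    · left
      obtain rfl : p = 1 := by omega
      omega
    · right
      obtain rfl : p = l := by omega
      have hs : s = 1 := by
        have : (l : ℤ) * s = l * 1 := by rw [hps, mul_one]
        exact mul_left_cancel₀ (by omega) this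
      refine ⟨((r + (l - 1)) / 2).toNat, ?_, ?_, ?_, ?_, ?_⟩ <;> omega
  · rintro (⟨rfl, rfl, rfl, rfl⟩ | ⟨t, ht, rfl, rfl, rfl, rfl⟩)
    · refine ⟨⟨?_, ?_⟩, ?_⟩ <;> omega
    · refine ⟨⟨?_, ?_⟩, ?_⟩ <;> omega

theorem sum_polarPart_upper {l : ℕ} (hl : l.Prime) (hl2 : Odd l) {u v : ℝ}
    (hu : Real.sin (l * u) ≠ 0) (hv : Real.sin (l * v) ≠ 0) :
    ∑ M ∈ heilbronn l with M.2.1 = 0, polarPart u v M.1 M.2.1 M.2.2.1 M.2.2.2 =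
      Real.cot u * Real.cot v + l * (Real.cot (l * u) * Real.cot (l * v)) := by
  have hl0 : (l : ℝ) ≠ 0 := by exact_mod_cast hl.ne_zero
  have hlz : (l : ℤ) ≠ 0 := by exact_mod_cast hl.ne_zero
  rw [heilbronn_filter_eq_zero hl hl2, Finset.sum_insert, Finset.sum_image]
  rotate_left
  · intro a _ b _ h
    simp only [Prod.mk.injEq] at h
    omega
  · have := hl.one_lt
    simp only [Finset.mem_image, Prod.mk.injEq, not_exists, not_and]
    intro t _ h
    omega
  -- For `0 < k < l` the even numbers `r` with `|r| < l` represent all classes modulo `l`, hence so do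
  -- the `r * k`, and the sum of the residues at the `k`-th pole is `l * cot (l * v)`.
  have hinner (k : ℕ) (hk : k ∈ Finset.range l) :
      ∑ t ∈ Finset.range l, Real.cot (((2 * (t : ℤ) - (l - 1) : ℤ) : ℝ) * pole l 0 v k +
        (1 : ℤ) * v) = l * Real.cot (l * v) +
          if k = 0 then l * (Real.cot v - Real.cot (l * v)) else 0 := by
    split_ifs with hk0
    · subst hk0
      simp only [pole]
      simp
      ring
    · have hcop : (2 * k).Coprime l := by
        refine Nat.Coprime.mul_left (Nat.coprime_two_left.mpr hl2) ?_
        exact (Nat.coprime_of_lt_prime hk0 (Finset.mem_range.mp hk) hl).symm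
      have harg : (l : ℝ) * (v - (l - 1) * (k * Real.pi / l)) =
          l * v + ((-((l - 1) * k) : ℤ) : ℝ) * Real.pi := by
        push_cast
        field_simp
        ring
      have hs : Real.sin (l * (v - (l - 1) * (k * Real.pi / l))) ≠ 0 := by
        rw [harg, Real.sin_add_int_mul_pi]
        exact mul_ne_zero (zpow_ne_zero _ (by norm_num)) hv
      have key := sum_cot_add_mul_pi_div hcop _ hs
      rw [harg, cot_add_int_mul_pi] at key
      rw [add_zero, ← key]
      refine Finset.sum_congr rfl fun t _ => ?_
      congr 1
      unfold pole
      push_cast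
      simp only [Int.natAbs_natCast]
      ring
  have hsum := sum_cot_sub_pole (q := 0) (u := u) (v := v) hlz (by simpa using hu)
  have hmain : ∑ t ∈ Finset.range l, polarPart u v l 0 (2 * (t : ℤ) - (l - 1)) 1 =
      l * Real.cot (l * v) * Real.cot (l * u) +
        (Real.cot v - Real.cot (l * v)) * Real.cot u := by
    simp only [polarPart]
    rw [← Finset.mul_sum, Finset.sum_comm]
    simp only [← Finset.sum_mul, Int.natAbs_natCast] at hsum ⊢
    rw [Finset.sum_congr rfl fun k hk => by rw [hinner k hk, add_mul, ite_mul, zero_mul],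
      Finset.sum_add_distrib, ← Finset.mul_sum, hsum, Finset.sum_ite_eq' (Finset.range l) 0,
      if_pos (Finset.mem_range.mpr hl.pos)]
    simp only [pole]
    simp
    field_simp
  have hone : polarPart u v 1 0 0 l = Real.cot (l * v) * Real.cot u := by
    simp [polarPart, pole]
  rw [hmain, hone]
  ring

theorem sum_heilbronn_cot_mul_cot {l : ℕ} (hl : l.Prime) (hl2 : Odd l) {u v : ℝ}
    (h : ∀ m n : ℤ, Odd (m + n) → Real.sin (m * u + n * v) ≠ 0) :
    ∑ M ∈ heilbronn l,
        Real.cot (M.1 * u + M.2.1 * v) * Real.cot (M.2.2.1 * u + M.2.2.2 * v) =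
      Real.cot u * Real.cot v + l * (Real.cot (l * u) * Real.cot (l * v)) := by
  have hl2' : Odd (l : ℤ) := by exact_mod_cast hl2
  have hu : Real.sin (l * u) ≠ 0 := by simpa using h l 0 (by simpa using hl2')
  have hv : Real.sin (l * v) ≠ 0 := by simpa using h 0 l (by simpa using hl2')
  have hexp : ∀ M ∈ heilbronn l,
      Real.cot (M.1 * u + M.2.1 * v) * Real.cot (M.2.2.1 * u + M.2.2.2 * v) =
        -(M.2.2.1.sign : ℝ) + polarPart u v M.1 M.2.1 M.2.2.1 M.2.2.2 +
          polarPart u v M.2.2.1 M.2.2.2 M.1 M.2.1 := by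
    rintro ⟨p, q, r, s⟩ hM
    obtain ⟨h1, h2, -, h4, h5, -⟩ := mem_heilbronn.mp hM
    exact cot_mul_cot_eq_polarPart ((abs_nonneg r).trans_lt h2) (h p q h4) (h r s h5)
      (by rw [h1]; exact_mod_cast hv)
  rw [Finset.sum_congr rfl hexp, Finset.sum_add_distrib, Finset.sum_add_distrib,
    Finset.sum_neg_distrib, sum_sign_heilbronn, neg_zero, zero_add,
    ← sum_polarPart_upper hl hl2 hu hv]
  have h1 := Finset.sum_filter_add_sum_filter_not (heilbronn l) (fun M => M.2.1 = 0)
    fun M => polarPart u v M.1 M.2.1 M.2.2.1 M.2.2.2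
  have h2 : ∑ M ∈ heilbronn l with M.2.2.1 ≠ 0, polarPart u v M.2.2.1 M.2.2.2 M.1 M.2.1 =
      ∑ M ∈ heilbronn l, polarPart u v M.2.2.1 M.2.2.2 M.1 M.2.1 := by
    refine Finset.sum_filter_of_ne fun M _ hM hr => hM ?_
    simp [polarPart, hr]
  have h3 := sum_polarPart_cancel l u v
  rw [h2] at h3
  simp only [ne_eq] at h3
  linear_combination -h1 + h3

/-! ### The change of coordinates -/

/-- The matrix that acts as `(p, q; r, s)` in the coordinates `(x + y) / 2`, `(x - y) / 2`.
The divisions are exact when the rows and columns of `(p, q; r, s)` have odd sums. -/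
def diagConj (M : ℤ × ℤ × ℤ × ℤ) : Matrix (Fin 2) (Fin 2) ℤ :=
  !![(M.1 + M.2.1 + M.2.2.1 + M.2.2.2) / 2, -((M.2.1 + M.2.2.2 - M.1 - M.2.2.1) / 2);
    (M.1 + M.2.1 - M.2.2.1 - M.2.2.2) / 2, (M.1 + M.2.2.2 - M.2.1 - M.2.2.1) / 2]

/-- The matrix that acts as `(r, s; -p, -q)` in the coordinates `(x + y) / 2`, `(x - y) / 2`.
The divisions are exact when the rows and columns of `(p, q; r, s)` have odd sums. -/
def diagConjRot (M : ℤ × ℤ × ℤ × ℤ) : Matrix (Fin 2) (Fin 2) ℤ :=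
  !![(M.2.2.1 + M.2.2.2 - M.1 - M.2.1) / 2, -((M.1 + M.2.2.2 - M.2.2.1 - M.2.1) / 2);
    (M.1 + M.2.1 + M.2.2.1 + M.2.2.2) / 2, (M.1 + M.2.2.1 - M.2.1 - M.2.2.2) / 2]

theorem mem_U_iff {l : ℕ} {x y y' x' p q r s : ℤ} (hp : 2 * p = x + x' + y' - y)
    (hq : 2 * q = x - x' + y' + y) (hr : 2 * r = x - x' - y' - y)
    (hs : 2 * s = x + x' - y' + y) :
    (x * x' + y * y' = (l : ℤ) ∧ Odd x ∧ Odd x' ∧ Even y ∧ Even y' ∧ |y| < x ∧ |y'| < x') ↔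
      (p, q, r, s) ∈ heilbronn l ∧ 4 ∣ p + q - r - s := by
  have hdet : 4 * (p * s - q * r) = 4 * (x * x' + y * y') := by
    linear_combination 2 * s * hp + (x + x' + y' - y) * hs - 2 * r * hq - (x - x' + y' + y) * hr
  have hdet' : p * s - q * r = x * x' + y * y' := by omega
  rw [mem_heilbronn, hdet']
  simp only [Int.odd_iff, Int.even_iff, abs_lt]
  constructor
  · rintro ⟨h, h1, h2, h3, h4, h5, h6⟩
    refine ⟨⟨h, ?_⟩, ?_⟩ <;> omega
  · rintro ⟨⟨h, h1, h2, h3, h4, h5, h6⟩, h7⟩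
    refine ⟨h, ?_⟩
    omega

theorem mem_V_iff {l : ℕ} {x y y' x' p q r s : ℤ} (hp : 2 * p = -x + x' + y' + y)
    (hq : 2 * q = -x - x' + y' - y) (hr : 2 * r = x + x' + y' - y)
    (hs : 2 * s = x - x' + y' + y) :
    (x * x' + y * y' = (l : ℤ) ∧ Odd x ∧ Odd x' ∧ Even y ∧ Even y' ∧ |x| < y ∧ |x'| < y') ↔
      (p, q, r, s) ∈ heilbronn l ∧ ¬ 4 ∣ p + q - r - s := by
  have hdet : 4 * (p * s - q * r) = 4 * (x * x' + y * y') := by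
    linear_combination 2 * s * hp + (-x + x' + y' + y) * hs - 2 * r * hq -
      (-x - x' + y' - y) * hr
  have hdet' : p * s - q * r = x * x' + y * y' := by omega
  rw [mem_heilbronn, hdet']
  simp only [Int.odd_iff, Int.even_iff, abs_lt]
  constructor
  · rintro ⟨h, h1, h2, h3, h4, h5, h6⟩
    refine ⟨⟨h, ?_⟩, ?_⟩ <;> omega
  · rintro ⟨⟨h, h1, h2, h3, h4, h5, h6⟩, h7⟩
    refine ⟨h, ?_⟩
    omega

theorem sum_U_eq (l : ℕ) (g : Matrix (Fin 2) (Fin 2) ℤ → ℝ) :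
    ∑ M ∈ (U_finite l).toFinset, g M =
      ∑ M ∈ heilbronn l with 4 ∣ M.1 + M.2.1 - M.2.2.1 - M.2.2.2, g (diagConj M) := by
  symm
  refine Finset.sum_nbij' diagConj
    (fun M => ((M 0 0 + M 1 1 + M 1 0 + M 0 1) / 2, (M 0 0 - M 1 1 + M 1 0 - M 0 1) / 2,
      (M 0 0 - M 1 1 - M 1 0 + M 0 1) / 2, (M 0 0 + M 1 1 - M 1 0 - M 0 1) / 2))
    ?_ ?_ ?_ ?_ fun _ _ => rfl
  · rintro ⟨p, q, r, s⟩ hM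
    rw [Finset.mem_filter] at hM
    rw [Set.Finite.mem_toFinset]
    obtain ⟨-, -, -, h1, h2, h3, h5⟩ := mem_heilbronn.mp hM.1
    simp only [Int.odd_iff] at h1 h2 h3 h5
    have h4 := hM.2
    simp only at h4
    refine ⟨_, _, _, _, rfl, (mem_U_iff ?_ ?_ ?_ ?_).mpr hM⟩ <;> dsimp only <;> omega
  · intro M hM
    rw [Set.Finite.mem_toFinset] at hM
    obtain ⟨x, y, y', x', rfl, h⟩ := hM
    obtain ⟨-, h1, h2, h3, h4, -⟩ := id h
    simp only [Int.odd_iff, Int.even_iff] at h1 h2 h3 h4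
    rw [Finset.mem_filter]
    refine (mem_U_iff ?_ ?_ ?_ ?_).mp h <;> simp <;> omega
  · rintro ⟨p, q, r, s⟩ hM
    rw [Finset.mem_filter, mem_heilbronn] at hM
    simp only [Int.odd_iff] at hM
    obtain ⟨⟨-, -, -, h1, h2, h3, h4⟩, h5⟩ := hM
    simp [diagConj]
    constructorm* _ ∧ _ <;> omega
  · intro M hM
    rw [Set.Finite.mem_toFinset] at hM
    obtain ⟨x, y, y', x', rfl, -, ⟨i, rfl⟩, ⟨j, rfl⟩, ⟨k, rfl⟩, ⟨m, rfl⟩, -⟩ := hM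
    simp [diagConj]
    constructorm* _ ∧ _ <;> omega

theorem sum_V_eq (l : ℕ) (g : Matrix (Fin 2) (Fin 2) ℤ → ℝ) :
    ∑ M ∈ (V_finite l).toFinset, g M =
      ∑ M ∈ heilbronn l with ¬ 4 ∣ M.1 + M.2.1 - M.2.2.1 - M.2.2.2, g (diagConjRot M) := by
  symm
  refine Finset.sum_nbij' diagConjRot
    (fun M => ((-M 0 0 + M 1 1 + M 1 0 - M 0 1) / 2, (-M 0 0 - M 1 1 + M 1 0 + M 0 1) / 2,
      (M 0 0 + M 1 1 + M 1 0 + M 0 1) / 2, (M 0 0 - M 1 1 + M 1 0 - M 0 1) / 2))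
    ?_ ?_ ?_ ?_ fun _ _ => rfl
  · rintro ⟨p, q, r, s⟩ hM
    rw [Finset.mem_filter] at hM
    rw [Set.Finite.mem_toFinset]
    obtain ⟨-, -, -, h1, h2, h3, h5⟩ := mem_heilbronn.mp hM.1
    simp only [Int.odd_iff] at h1 h2 h3 h5
    have h4 := hM.2
    simp only at h4
    refine ⟨_, _, _, _, rfl, (mem_V_iff ?_ ?_ ?_ ?_).mpr hM⟩ <;> dsimp only <;> omega
  · intro M hM
    rw [Set.Finite.mem_toFinset] at hM
    obtain ⟨x, y, y', x', rfl, h⟩ := hM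
    obtain ⟨-, h1, h2, h3, h4, -⟩ := id h
    simp only [Int.odd_iff, Int.even_iff] at h1 h2 h3 h4
    rw [Finset.mem_filter]
    refine (mem_V_iff ?_ ?_ ?_ ?_).mp h <;> simp <;> omega
  · rintro ⟨p, q, r, s⟩ hM
    rw [Finset.mem_filter, mem_heilbronn] at hM
    simp only [Int.odd_iff] at hM
    obtain ⟨⟨-, -, -, h1, h2, h3, h4⟩, h5⟩ := hM
    simp [diagConjRot]
    constructorm* _ ∧ _ <;> omega
  · intro M hM
    rw [Set.Finite.mem_toFinset] at hM
    obtain ⟨x, y, y', x', rfl, -, ⟨i, rfl⟩, ⟨j, rfl⟩, ⟨k, rfl⟩, ⟨m, rfl⟩, -⟩ := hM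
    simp [diagConjRot]
    constructorm* _ ∧ _ <;> omega

theorem cosQuot_eq_cot_mul_cot (N : ℕ) (x y : ℤ) :
    cosQuot N x y = 1 / 4 * (Real.cot (Real.pi * (x + y) / (2 * N)) *
      Real.cot (Real.pi * (x - y) / (2 * N))) := by
  have h1 : (Real.pi * x / N + Real.pi * y / N) / 2 = Real.pi * (x + y) / (2 * N) := by
    rw [← add_div, ← mul_add, div_div, mul_comm (N : ℝ)]
  have h2 : (Real.pi * x / N - Real.pi * y / N) / 2 = Real.pi * (x - y) / (2 * N) := by
    rw [← sub_div, ← mul_sub, div_div, mul_comm (N : ℝ)]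
  rw [cosQuot, Real.cos_add_cos, Real.cos_sub_cos, h1, h2, Real.cot_eq_cos_div_sin,
    Real.cot_eq_cos_div_sin, div_mul_div_comm, mul_assoc, mul_assoc (-2 : ℝ), neg_mul (2 : ℝ), div_neg,
    mul_div_mul_left _ _ (two_ne_zero' ℝ)]
  ring

/-- The hypotheses on `L` say that it acts as `(p, q; r, s)` on `(u, v)`. -/
theorem F_mulVec {N : ℕ} (hN : Odd N) {P : Fin 2 → ZMod N} {a b : ℤ} (ha : (a : ZMod N) = P 0)
    (hb : (b : ZMod N) = P 1) (hab : Odd (a - b)) {L : Matrix (Fin 2) (Fin 2) ℤ} {p q r s : ℤ}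
    (h00 : 2 * L 0 0 = p + q + r + s) (h01 : 2 * L 0 1 = p - q + r - s)
    (h10 : 2 * L 1 0 = p + q - r - s) (h11 : 2 * L 1 1 = p - q - r + s)
    (hrs : Odd (r + s)) {u v : ℝ} (hu : u = Real.pi * (a + b) / (2 * N))
    (hv : v = Real.pi * (a - b) / (2 * N)) :
    F N (L.map (Int.cast : ℤ → ZMod N) *ᵥ P) =
      1 / 4 * (Real.cot (p * u + q * v) * Real.cot (r * u + s * v)) := by
  obtain ⟨w, hw⟩ : ∃ w, w = L 0 0 := ⟨_, rfl⟩
  obtain ⟨x, hx⟩ : ∃ x, x = L 0 1 := ⟨_, rfl⟩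
  obtain ⟨y, hy⟩ : ∃ y, y = L 1 0 := ⟨_, rfl⟩
  obtain ⟨z, hz⟩ : ∃ z, z = L 1 1 := ⟨_, rfl⟩
  rw [← hw] at h00
  rw [← hx] at h01
  rw [← hy] at h10
  rw [← hz] at h11
  rw [F_eq hN _ (w * a + x * b) (y * a + z * b), cosQuot_eq_cot_mul_cot]
  · have e1 : (p + q : ℝ) = w + y := by exact_mod_cast (by omega : p + q = w + y)
    have e2 : (p - q : ℝ) = x + z := by exact_mod_cast (by omega : p - q = x + z)
    have e3 : (r + s : ℝ) = w - y := by exact_mod_cast (by omega : r + s = w - y)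
    have e4 : (r - s : ℝ) = x - z := by exact_mod_cast (by omega : r - s = x - z)
    congr 3 <;> rw [hu, hv] <;> push_cast
    · linear_combination (-Real.pi * a / (2 * N)) * e1 - (Real.pi * b / (2 * N)) * e2
    · linear_combination (-Real.pi * a / (2 * N)) * e3 - (Real.pi * b / (2 * N)) * e4
  · simp [mulVec, dotProduct, Fin.sum_univ_two, ha, hb, hw, hx]
  · simp [mulVec, dotProduct, Fin.sum_univ_two, ha, hb, hy, hz]
  · have e1 : w - y = r + s := by omega
    have e2 : x - z = r - s := by omega
    have : w * a + x * b - (y * a + z * b) = (r + s) * (a - b) + 2 * (r * b) := by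
      linear_combination a * e1 + b * e2
    rw [this]
    exact (hrs.mul hab).add_even (even_two_mul _)

theorem sum_theta (l : ℕ) (g : Matrix (Fin 2) (Fin 2) ℤ → ℝ) :
    ((theta l).sum fun L u => (u : ℝ) * g L) =
      ∑ M ∈ (U_finite l).toFinset, g M - ∑ M ∈ (V_finite l).toFinset, g M := by
  have hz (L : Matrix (Fin 2) (Fin 2) ℤ) : ((0 : ℤ) : ℝ) * g L = 0 := by simp
  have ha (L : Matrix (Fin 2) (Fin 2) ℤ) (m n : ℤ) :
      ((m + n : ℤ) : ℝ) * g L = m * g L + n * g L := by push_cast; ring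
  rw [theta, Finsupp.sum_sub_index fun L m n => by push_cast; ring,
    ← Finsupp.sum_finsetSum_index hz ha, ← Finsupp.sum_finsetSum_index hz ha]
  simp [Finsupp.sum_single_index]

end EisensteinCycles

open EisensteinCycles

theorem proposition10 (N : ℕ) (hN : Odd N) (l : ℕ) (hl : l.Prime) (hl2 : Odd l)
    (P : Fin 2 → ZMod N) :
    ((EisensteinCycles.theta l).sum fun L u =>
        (u : ℝ) * EisensteinCycles.F N (L.map (Int.cast : ℤ → ZMod N) *ᵥ P)) =
      EisensteinCycles.F N P + (l : ℝ) * EisensteinCycles.F N ((l : ZMod N) • P) := by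
  obtain ⟨a, b, ha, hb, hab⟩ := exists_rep hN P
  have hN0 : (N : ℝ) ≠ 0 := by exact_mod_cast hN.pos.ne'
  obtain ⟨u, hu⟩ : ∃ u, u = Real.pi * (a + b) / (2 * N) := ⟨_, rfl⟩
  obtain ⟨v, hv⟩ : ∃ v, v = Real.pi * (a - b) / (2 * N) := ⟨_, rfl⟩
  -- A zero of the sine would make the odd number `m * (a + b) + n * (a - b)` a multiple of `2 * N`.
  have hsin (m n : ℤ) (hmn : Odd (m + n)) : Real.sin (m * u + n * v) ≠ 0 := by
    intro h0
    obtain ⟨k, hk⟩ := Real.sin_eq_zero_iff.mp h0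
    rw [hu, hv] at hk
    have hpi := Real.pi_ne_zero
    field_simp at hk
    have hk' : 2 * (N * k) = (m + n) * (a - b) + 2 * (m * b) := by
      have : (2 * (N * k) : ℝ) = (m + n) * (a - b) + 2 * (m * b) := by linear_combination hk
      exact_mod_cast this
    have := hmn.mul hab
    rw [Int.odd_iff] at this
    omega
  have hFP : F N P = 1 / 4 * (Real.cot u * Real.cot v) := by
    rw [F_eq hN P a b ha hb hab, cosQuot_eq_cot_mul_cot, hu, hv]
  have hFlP : F N ((l : ZMod N) • P) = 1 / 4 * (Real.cot (l * u) * Real.cot (l * v)) := by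
    rw [F_eq hN _ (l * a) (l * b) (by simp [ha]) (by simp [hb])
      (by rw [← mul_sub]; exact (by exact_mod_cast hl2 : Odd (l : ℤ)).mul hab),
      cosQuot_eq_cot_mul_cot, hu, hv]
    push_cast
    congr 3 <;> ring
  rw [sum_theta l fun L => F N (L.map (Int.cast : ℤ → ZMod N) *ᵥ P), sum_U_eq, sum_V_eq,
    hFP, hFlP]
  have hU : ∀ M ∈ (heilbronn l).filter (fun M => 4 ∣ M.1 + M.2.1 - M.2.2.1 - M.2.2.2),
      F N ((diagConj M).map (Int.cast : ℤ → ZMod N) *ᵥ P) =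
        1 / 4 * (Real.cot (M.1 * u + M.2.1 * v) * Real.cot (M.2.2.1 * u + M.2.2.2 * v)) := by
    rintro ⟨p, q, r, s⟩ hM
    rw [Finset.mem_filter, mem_heilbronn] at hM
    obtain ⟨⟨-, -, -, h1, h2, h3, h4⟩, h5⟩ := id hM
    simp only [Int.odd_iff] at h1 h2 h3 h4
    refine F_mulVec hN ha hb hab ?_ ?_ ?_ ?_ hM.1.2.2.2.2.1 hu hv <;> simp [diagConj] <;> omega
  have hV : ∀ M ∈ (heilbronn l).filter (fun M => ¬ 4 ∣ M.1 + M.2.1 - M.2.2.1 - M.2.2.2),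
      F N ((diagConjRot M).map (Int.cast : ℤ → ZMod N) *ᵥ P) =
        -(1 / 4 * (Real.cot (M.1 * u + M.2.1 * v) * Real.cot (M.2.2.1 * u + M.2.2.2 * v))) := by
    rintro ⟨p, q, r, s⟩ hM
    rw [Finset.mem_filter, mem_heilbronn] at hM
    obtain ⟨⟨-, -, -, h1, h2, h3, h4⟩, h5⟩ := id hM
    simp only [Int.odd_iff] at h1 h2 h3 h4
    rw [F_mulVec (p := r) (q := s) (r := -p) (s := -q) hN ha hb hab
      (by simp [diagConjRot]; omega) (by simp [diagConjRot]; omega)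
      (by simp [diagConjRot]; omega) (by simp [diagConjRot]; omega)
      (by rw [Int.odd_iff]; omega) hu hv]
    have hneg : ((-p : ℤ) : ℝ) * u + ((-q : ℤ) : ℝ) * v = -(p * u + q * v) := by push_cast; ring
    rw [hneg, cot_neg]
    ring
  rw [Finset.sum_congr rfl hU, Finset.sum_congr rfl hV, Finset.sum_neg_distrib, sub_neg_eq_add,
    Finset.sum_filter_add_sum_filter_not, ← Finset.mul_sum, sum_heilbronn_cot_mul_cot hl hl2 hsin]
  ring
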